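/- Let $p$ be a prime, let $F=\overline{\mathbb F}_p$ be an algebraic closure of $\mathbb F_p$, and let $n\ge 3$. Let $\Gamma=\mathrm{Gr}_{1,n}(A_n(F))$ be the following point-line geometry. A flag is a set of pairwise comparable (under inclusion) nonzero proper vector subspaces of $F^{n+1}$, and its type is the set of dimensions of its members. The points of $\Gamma$ are the flags of type $\{1,n\}$; its lines are the flags of type $\{2,n\}$ or $\{1,n-1\}$; a point $x$ and a line $\ell$ are incident if and only if $x\cup\ell$ is a flag. A subspace of $\Gamma$ is a set of points that contains all points of every line meeting it in at least two points. A set $X$ of points generates $\Gamma$ if the only subspace containing $X$ is the whole point set. The generating rank of $\Gamma$ is the smallest cardinality of a set of points that generates $\Gamma$. A projective embedding of $\Gamma$ is an injective map $e$ from the point set of $\Gamma$ to the set of points of the projective space $\mathrm{PG}(V)$ of a vector space $V$ over some division ring, such that for every line $\ell$ of $\Gamma$ the set $\{e(x) : x \text{ a point on } \ell\}$ is a projective line of $\mathrm{PG}(V)$, and such that the image of $e$ spans $\mathrm{PG}(V)$. Its dimension is $\dim V$. The embedding rank of $\Gamma$ is the supremum of the dimensions of all projective embeddings of $\Gamma$,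 over all division rings. Then the generating rank of $\Gamma$ is infinite, and the embedding rank of $\Gamma$ is equal to either $(n+1)^2-1$ or $(n+1)^2$. -/

import Mathlib

universe u

/-- A point-line geometry, given by its points, its lines and their incidence relation. -/
structure PointLineGeometry where
  Point : Type u
  Line : Type u
  Inc : Point → Line → Prop

namespace PointLineGeometry

/-- The set of points incident with a line. -/
def pointsOn (Γ : PointLineGeometry.{u}) (l : Γ.Line) : Set Γ.Point :=
  {x | Γ.Inc x l}

/-- A subspace is a set of points containing all points of every line
that meets it in at least two distinct points. -/
def IsSubspace (Γ : PointLineGeometry.{u}) (S : Set Γ.Point) : Prop :=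
  ∀ (l : Γ.Line) (x y : Γ.Point), x ≠ y → x ∈ S → y ∈ S →
    x ∈ Γ.pointsOn l → y ∈ Γ.pointsOn l → Γ.pointsOn l ⊆ S

/-- The subspace generated by a set of points: the intersection of all subspaces containing it. -/
def span (Γ : PointLineGeometry.{u}) (X : Set Γ.Point) : Set Γ.Point :=
  ⋂₀ {S | Γ.IsSubspace S ∧ X ⊆ S}

/-- The generating rank: the smallest cardinality of a set of points that generates the geometry. -/
noncomputable def generatingRank (Γ : PointLineGeometry.{u}) : Cardinal.{u} :=
  sInf {c | ∃ X : Set Γ.Point, Γ.span X = Set.univ ∧ Cardinal.mk X = c}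

/-- A set of points of the projective space of `V` is a projective line when it consists of
all points contained in some two-dimensional vector subspace. -/
def IsProjectiveLine (K V : Type u) [DivisionRing K] [AddCommGroup V] [Module K V]
    (S : Set (Projectivization K V)) : Prop :=
  ∃ W : Submodule K V, Module.finrank K W = 2 ∧ S = {x | x.submodule ≤ W}

/-- A (full) projective embedding of `Γ` in the projective space of `V`. -/
structure ProjectiveEmbedding (Γ : PointLineGeometry.{u}) (K V : Type u)
    [DivisionRing K] [AddCommGroup V] [Module K V] where
  toFun : Γ.Point → Projectivization K V
  injective : Function.Injective toFun
  image_line : ∀ l : Γ.Line, IsProjectiveLine K V (toFun '' Γ.pointsOn l)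
  spanning : ⨆ x : Γ.Point, (toFun x).submodule = ⊤

/-- The embedding rank: the supremum of the dimensions of all projective embeddings, over all
division rings. The restriction to the universe of `Γ` loses no dimension: the images of the
points span `V`, and a line of `Γ` is in bijection with a projective line over `K`, so that
every embedding is isomorphic to one in this universe (in a geometry without lines the
division ring is arbitrary). -/
noncomputable def embeddingRank (Γ : PointLineGeometry.{u}) : Cardinal.{u} :=
  sSup {c | ∃ (K : Type u) (_ : DivisionRing K) (V : Type u) (_ : AddCommGroup V)
    (_ : Module K V), Nonempty (Γ.ProjectiveEmbedding K V) ∧ Module.rank K V = c}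

end PointLineGeometry

namespace BuildingA

/-- The flags of the building of type `A_n` over `F`: sets of pairwise comparable
nonzero proper vector subspaces of the space of dimension `n + 1`. -/
def IsFlag (F : Type u) [Field F] (n : ℕ) (S : Set (Submodule F (Fin (n + 1) → F))) : Prop :=
  (∀ W ∈ S, W ≠ ⊥ ∧ W ≠ ⊤) ∧ ∀ W ∈ S, ∀ U ∈ S, W ≤ U ∨ U ≤ W

/-- The type of a flag: the set of dimensions of its members. -/
def flagType (F : Type u) [Field F] (n : ℕ) (S : Set (Submodule F (Fin (n + 1) → F))) : Set ℕ :=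
  {d | ∃ W ∈ S, Module.finrank F W = d}

/-- The nodes adjacent to `j` in the diagram `A_n`, whose nodes are `1, …, n`. -/
def adjacentNodes (n j : ℕ) : Set ℕ :=
  {i | 1 ≤ i ∧ i ≤ n ∧ (i + 1 = j ∨ j + 1 = i)}

/-- The `J`-Grassmannian of the building of type `A_n` over `F`. The points are the flags of
type `J`; the lines are the flags of type `(J \ {j}) ∪ fr(j)` with `j ∈ J`, where `fr(j)` is the
set of nodes adjacent to `j`; a point and a line are incident when their union is a flag. -/
def grassmannian (F : Type u) [Field F] (n : ℕ) (J : Set ℕ) : PointLineGeometry.{u} where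
  Point := {S : Set (Submodule F (Fin (n + 1) → F)) // IsFlag F n S ∧ flagType F n S = J}
  Line := {S : Set (Submodule F (Fin (n + 1) → F)) // IsFlag F n S ∧
    ∃ j ∈ J, flagType F n S = (J \ {j}) ∪ adjacentNodes n j}
  Inc x l := IsFlag F n (x.1 ∪ l.1)

end BuildingA

/-! A point of the geometry is a pair `(P, H)` with `P = ⟨v⟩` and `H = w^⊥`, where `w ⬝ᵥ v = 0`. A
line lets one of `v`, `w` run through a two-dimensional space while the other is fixed. Everything
rests on the fact that finitely many elements of `F` lie in a finite subfield `E`.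

Generating rank: given a finite set of points, choose `E` containing coordinates of all their `P`. A
power `σ` of Frobenius fixes `E` elementwise but is not the identity on the infinite field `F`. The
pairs with `σ(P) ≤ H` form a subspace (`isSubspace_twistedIncidence`) that contains the given
points, since `σ(P)` spans `P` for them, and is proper. So no finite set generates.

Upper bound for the embedding rank: although the geometry is not finitely generated, for each finite
`E` some `(n + 1) ^ 2` points generate a subspace containing every pair whose `P` is rational over
`E` (`mem_of_generatorCoord`). These points depend on `E` only through a generator of the cyclic
group `Eˣ`, and their number does not depend on `E`. Hence in any embedding finitely many image
points lie in the span of `(n + 1) ^ 2` vectors, which bounds the dimension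
(`rank_le_of_embedding`).

Lower bound: `(v, f) ↦ f ⊗ v` embeds the geometry in the span of the nilpotent endomorphisms of rank
one (`exists_embedding`), which has codimension at most one in the endomorphism space
(`le_finrank_rankOneSpan`). -/

namespace BuildingA

open Module

variable {F : Type u} [Field F] {n : ℕ}

/-! ### Flags with two members; points and lines of the point-hyperplane geometry -/

theorem IsFlag.exists_eq_pair {S : Set (Submodule F (Fin (n + 1) → F))} {a b : ℕ}
    (hS : IsFlag F n S) (hab : a < b) (ht : flagType F n S = {a, b}) :
    ∃ A B, S = {A, B} ∧ A ≤ B ∧ finrank F A = a ∧ finrank F B = b := by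
  obtain ⟨A, hA, hAa⟩ : a ∈ flagType F n S := by simp [ht]
  obtain ⟨B, hB, hBb⟩ : b ∈ flagType F n S := by simp [ht]
  have eq_of_finrank : ∀ W ∈ S, ∀ U ∈ S, finrank F W = finrank F U → W = U := by
    intro W hW U hU h
    rcases hS.2 W hW U hU with h' | h'
    · exact Submodule.eq_of_le_of_finrank_eq h' h
    · exact (Submodule.eq_of_le_of_finrank_eq h' h.symm).symm
  refine ⟨A, B, ?_, ?_, hAa, hBb⟩
  · ext W
    simp only [Set.mem_insert_iff, Set.mem_singleton_iff]
    constructor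
    · intro hW
      have : finrank F W ∈ flagType F n S := ⟨W, hW, rfl⟩
      rw [ht] at this
      rcases this with h | h
      · exact Or.inl (eq_of_finrank W hW A hA (h.trans hAa.symm))
      · exact Or.inr (eq_of_finrank W hW B hB (Eq.trans h hBb.symm))
    · rintro (rfl | rfl) <;> assumption
  · rcases hS.2 A hA B hB with h | h
    · exact h
    · have := Submodule.finrank_mono h
      omega

theorem isFlag_pair {A B : Submodule F (Fin (n + 1) → F)} (h : A ≤ B)
    (hA : 0 < finrank F A) (hB : finrank F B < n + 1) : IsFlag F n {A, B} := by
  have hAB := Submodule.finrank_mono h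
  have key : ∀ W : Submodule F (Fin (n + 1) → F),
      0 < finrank F W → finrank F W < n + 1 → W ≠ ⊥ ∧ W ≠ ⊤ := by
    intro W h0 h1
    constructor
    · rintro rfl
      simp at h0
    · rintro rfl
      simp at h1
  refine ⟨?_, ?_⟩
  · rintro W (rfl | rfl)
    · exact key _ hA (by omega)
    · exact key _ (by omega) hB
  · rintro W (rfl | rfl) U (rfl | rfl) <;> simp [h]

theorem flagType_pair (A B : Submodule F (Fin (n + 1) → F)) :
    flagType F n {A, B} = {finrank F A, finrank F B} := by
  ext d
  simp [flagType, eq_comm]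

theorem IsFlag.union_iff {S T : Set (Submodule F (Fin (n + 1) → F))} (hS : IsFlag F n S)
    (hT : IsFlag F n T) : IsFlag F n (S ∪ T) ↔ ∀ W ∈ S, ∀ U ∈ T, W ≤ U ∨ U ≤ W := by
  constructor
  · intro h W hW U hU
    exact h.2 W (Or.inl hW) U (Or.inr hU)
  · intro h
    refine ⟨?_, ?_⟩
    · rintro W (hW | hW)
      exacts [hS.1 W hW, hT.1 W hW]
    · rintro W (hW | hW) U (hU | hU)
      exacts [hS.2 W hW U hU, h W hW U hU, (h U hU W hW).symm, hT.2 W hW U hU]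

theorem adjacentNodes_one (hn : 3 ≤ n) : adjacentNodes n 1 = {2} := by
  ext i
  simp only [adjacentNodes, Set.mem_ofPred_eq, Set.mem_singleton_iff]
  omega

theorem adjacentNodes_self (hn : 3 ≤ n) : adjacentNodes n n = {n - 1} := by
  ext i
  simp only [adjacentNodes, Set.mem_ofPred_eq, Set.mem_singleton_iff]
  omega

/-- The geometry of incident point-hyperplane pairs. -/
abbrev pointHyperplane (F : Type u) [Field F] (n : ℕ) : PointLineGeometry.{u} :=
  grassmannian F n {1, n}

namespace pointHyperplane

/-- The point of an incident point-hyperplane pair. -/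
def pt (x : (pointHyperplane F n).Point) : Submodule F (Fin (n + 1) → F) := sInf x.1

/-- The hyperplane of an incident point-hyperplane pair. -/
def hy (x : (pointHyperplane F n).Point) : Submodule F (Fin (n + 1) → F) := sSup x.1

theorem pt_hy_spec (hn : 3 ≤ n) (x : (pointHyperplane F n).Point) :
    x.1 = {pt x, hy x} ∧ pt x ≤ hy x ∧ finrank F (pt x) = 1 ∧ finrank F (hy x) = n := by
  obtain ⟨A, B, h, hAB, hA, hB⟩ := x.2.1.exists_eq_pair (by omega) x.2.2
  have hp : pt x = A := by simp [pt, h, hAB]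
  have hh : hy x = B := by simp [hy, h, hAB]
  rw [hp, hh]
  exact ⟨h, hAB, hA, hB⟩

theorem exists_eq_span {P : Submodule F (Fin (n + 1) → F)} (hP : finrank F P = 1) :
    ∃ v, v ≠ 0 ∧ P = Submodule.span F {v} := by
  obtain ⟨v, hv, h⟩ := finrank_eq_one_iff'.1 hP
  refine ⟨v, by simpa using hv, le_antisymm (fun w hw => ?_) ?_⟩
  · obtain ⟨c, hc⟩ := h ⟨w, hw⟩
    exact Submodule.mem_span_singleton.2 ⟨c, congrArg Subtype.val hc⟩
  · simp

theorem finrank_ker {f : Dual F (Fin (n + 1) → F)} (hf : f ≠ 0) :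
    finrank F (LinearMap.ker f) = n := by
  have hker := Module.Dual.finrank_ker_add_one_of_ne_zero hf
  rw [finrank_fintype_fun_eq_card, Fintype.card_fin] at hker
  omega

theorem exists_eq_ker {H : Submodule F (Fin (n + 1) → F)} (hH : finrank F H = n) :
    ∃ f : Dual F (Fin (n + 1) → F), f ≠ 0 ∧ H = LinearMap.ker f := by
  have hlt : H < ⊤ := by
    rw [lt_top_iff_ne_top]
    rintro rfl
    rw [finrank_top, finrank_fintype_fun_eq_card, Fintype.card_fin] at hH
    omega
  obtain ⟨f, hf, hle⟩ := Submodule.exists_le_ker_of_lt_top _ hlt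
  exact ⟨f, hf, Submodule.eq_of_le_of_finrank_eq hle (hH.trans (finrank_ker hf).symm)⟩

theorem ext (hn : 3 ≤ n) {x y : (pointHyperplane F n).Point} (h₁ : pt x = pt y)
    (h₂ : hy x = hy y) : x = y := by
  apply Subtype.ext
  rw [(pt_hy_spec hn x).1, (pt_hy_spec hn y).1, h₁, h₂]

theorem exists_point {A B : Submodule F (Fin (n + 1) → F)} (hAB : A ≤ B)
    (hA : finrank F A = 1) (hB : finrank F B = n) :
    ∃ x : (pointHyperplane F n).Point, pt x = A ∧ hy x = B := by
  refine ⟨⟨{A, B}, isFlag_pair hAB (by omega) (by omega), by rw [flagType_pair, hA, hB]⟩, ?_, ?_⟩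
  · simp [pt, hAB]
  · simp [hy, hAB]

/-- Comparable subspaces of equal dimension coincide, which forces `hy x = H`; the inclusion `pt x ≤
L` has its direction forced by dimension. -/
theorem inc_iff_of_two (hn : 3 ≤ n) {l : (pointHyperplane F n).Line}
    {L H : Submodule F (Fin (n + 1) → F)} (hl : l.1 = {L, H}) (hLH : L ≤ H)
    (hL : finrank F L = 2) (hH : finrank F H = n) (x : (pointHyperplane F n).Point) :
    (pointHyperplane F n).Inc x l ↔ pt x ≤ L ∧ hy x = H := by
  obtain ⟨hx, hle, h1, h2⟩ := pt_hy_spec hn x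
  change IsFlag F n (x.1 ∪ l.1) ↔ _
  rw [x.2.1.union_iff l.2.1, hx, hl]
  simp only [Set.mem_insert_iff, Set.mem_singleton_iff, forall_eq_or_imp, forall_eq]
  constructor
  · rintro ⟨⟨h, -⟩, -, h'⟩
    refine ⟨h.resolve_right fun h => ?_, ?_⟩
    · have := Submodule.finrank_mono h
      omega
    · rcases h' with h' | h'
      · exact Submodule.eq_of_le_of_finrank_eq h' (by omega)
      · exact (Submodule.eq_of_le_of_finrank_eq h' (by omega)).symm
  · rintro ⟨h, rfl⟩
    exact ⟨⟨Or.inl h, Or.inl hle⟩, Or.inr hLH, Or.inl le_rfl⟩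

theorem inc_iff_of_codim_two (hn : 3 ≤ n) {l : (pointHyperplane F n).Line}
    {P M : Submodule F (Fin (n + 1) → F)} (hl : l.1 = {P, M}) (hPM : P ≤ M)
    (hP : finrank F P = 1) (hM : finrank F M = n - 1) (x : (pointHyperplane F n).Point) :
    (pointHyperplane F n).Inc x l ↔ pt x = P ∧ M ≤ hy x := by
  obtain ⟨hx, hle, h1, h2⟩ := pt_hy_spec hn x
  change IsFlag F n (x.1 ∪ l.1) ↔ _
  rw [x.2.1.union_iff l.2.1, hx, hl]
  simp only [Set.mem_insert_iff, Set.mem_singleton_iff, forall_eq_or_imp, forall_eq]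
  constructor
  · rintro ⟨⟨h, -⟩, -, h'⟩
    refine ⟨?_, h'.resolve_left fun h => ?_⟩
    · rcases h with h' | h'
      · exact Submodule.eq_of_le_of_finrank_eq h' (by omega)
      · exact (Submodule.eq_of_le_of_finrank_eq h' (by omega)).symm
    · have := Submodule.finrank_mono h
      omega
  · rintro ⟨rfl, h⟩
    exact ⟨⟨Or.inl le_rfl, Or.inl hPM⟩, Or.inr hle, Or.inr h⟩

theorem exists_line_two (hn : 3 ≤ n) {L H : Submodule F (Fin (n + 1) → F)} (hLH : L ≤ H)
    (hL : finrank F L = 2) (hH : finrank F H = n) :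
    ∃ l : (pointHyperplane F n).Line,
      ∀ x, (pointHyperplane F n).Inc x l ↔ pt x ≤ L ∧ hy x = H := by
  refine ⟨⟨{L, H}, isFlag_pair hLH (by omega) (by omega), 1, by simp, ?_⟩,
    inc_iff_of_two hn rfl hLH hL hH⟩
  rw [flagType_pair, hL, hH, adjacentNodes_one hn]
  ext d
  simp only [Set.mem_insert_iff, Set.mem_singleton_iff, Set.mem_union, Set.mem_sdiff]
  omega

theorem exists_line_codim_two (hn : 3 ≤ n) {P M : Submodule F (Fin (n + 1) → F)} (hPM : P ≤ M)
    (hP : finrank F P = 1) (hM : finrank F M = n - 1) :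
    ∃ l : (pointHyperplane F n).Line,
      ∀ x, (pointHyperplane F n).Inc x l ↔ pt x = P ∧ M ≤ hy x := by
  refine ⟨⟨{P, M}, isFlag_pair hPM (by omega) (by omega), n, by simp, ?_⟩,
    inc_iff_of_codim_two hn rfl hPM hP hM⟩
  rw [flagType_pair, hP, hM, adjacentNodes_self hn]
  ext d
  simp only [Set.mem_insert_iff, Set.mem_singleton_iff, Set.mem_union, Set.mem_sdiff]
  omega

/-- Every line consists either of the pairs with a fixed hyperplane and a point on a given
projective line, or of the pairs with a fixed point and a hyperplane through a given subspace
of codimension two. -/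
theorem line_cases (hn : 3 ≤ n) (l : (pointHyperplane F n).Line) :
    (∃ L H : Submodule F (Fin (n + 1) → F), L ≤ H ∧ finrank F L = 2 ∧ finrank F H = n ∧
      ∀ x, (pointHyperplane F n).Inc x l ↔ pt x ≤ L ∧ hy x = H) ∨
    ∃ P M : Submodule F (Fin (n + 1) → F), P ≤ M ∧ finrank F P = 1 ∧ finrank F M = n - 1 ∧
      ∀ x, (pointHyperplane F n).Inc x l ↔ pt x = P ∧ M ≤ hy x := by
  obtain ⟨j, hj, ht⟩ := l.2.2
  rcases hj with rfl | hj
  · left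
    have : flagType F n l.1 = {2, n} := by
      rw [ht, adjacentNodes_one hn]
      ext d
      simp only [Set.mem_insert_iff, Set.mem_singleton_iff, Set.mem_union, Set.mem_sdiff]
      omega
    obtain ⟨L, H, h, hLH, hL, hH⟩ := l.2.1.exists_eq_pair (by omega) this
    exact ⟨L, H, hLH, hL, hH, inc_iff_of_two hn h hLH hL hH⟩
  · right
    have : flagType F n l.1 = {1, n - 1} := by
      rw [ht, Set.mem_singleton_iff.1 hj, adjacentNodes_self hn]
      ext d
      simp only [Set.mem_insert_iff, Set.mem_singleton_iff, Set.mem_union, Set.mem_sdiff]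
      omega
    obtain ⟨P, M, h, hPM, hP, hM⟩ := l.2.1.exists_eq_pair (by omega) this
    exact ⟨P, M, hPM, hP, hM, inc_iff_of_codim_two hn h hPM hP hM⟩

theorem sup_eq_of_finrank {L P Q : Submodule F (Fin (n + 1) → F)} (hL : finrank F L = 2)
    (hP : finrank F P = 1) (hQ : finrank F Q = 1) (hPL : P ≤ L) (hQL : Q ≤ L) (hPQ : P ≠ Q) :
    P ⊔ Q = L := by
  apply Submodule.eq_of_le_of_finrank_le (sup_le hPL hQL)
  have : P < P ⊔ Q := by
    refine lt_of_le_of_ne le_sup_left fun h => hPQ ?_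
    exact (Submodule.eq_of_le_of_finrank_eq (h ▸ le_sup_right : Q ≤ P) (by omega)).symm
  have := Submodule.finrank_lt_finrank_of_lt this
  omega

theorem finrank_sup_of_ne {P Q : Submodule F (Fin (n + 1) → F)}
    (hP : finrank F P = 1) (hQ : finrank F Q = 1) (hPQ : P ≠ Q) :
    finrank F ↥(P ⊔ Q) = 2 := by
  have h := Submodule.finrank_sup_add_finrank_inf_eq P Q
  have : P ⊓ Q < P := by
    refine lt_of_le_of_ne inf_le_left fun h => hPQ ?_
    exact (Submodule.eq_of_le_of_finrank_eq (inf_eq_left.1 h) (by omega))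
  have := Submodule.finrank_lt_finrank_of_lt this
  omega

theorem finrank_inf_of_ne {H K : Submodule F (Fin (n + 1) → F)}
    (hH : finrank F H = n) (hK : finrank F K = n) (hHK : H ≠ K) :
    finrank F ↥(H ⊓ K) = n - 1 := by
  have h := Submodule.finrank_sup_add_finrank_inf_eq H K
  have : H < H ⊔ K := by
    refine lt_of_le_of_ne le_sup_left fun h => hHK ?_
    exact (Submodule.eq_of_le_of_finrank_eq (h ▸ le_sup_right : K ≤ H) (by omega)).symm
  have := Submodule.finrank_lt_finrank_of_lt this
  have h' := Submodule.finrank_le (H ⊔ K)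
  simp only [finrank_fintype_fun_eq_card, Fintype.card_fin] at h'
  omega

theorem inf_eq_of_finrank {M H K : Submodule F (Fin (n + 1) → F)} (hM : finrank F M = n - 1)
    (hH : finrank F H = n) (hK : finrank F K = n) (hMH : M ≤ H) (hMK : M ≤ K) (hHK : H ≠ K) :
    M = H ⊓ K :=
  Submodule.eq_of_le_of_finrank_eq (le_inf hMH hMK) (by rw [hM, finrank_inf_of_ne hH hK hHK])

end pointHyperplane

end BuildingA

/-! ### A criterion for infinite generating rank -/

namespace PointLineGeometry

theorem span_subset {Γ : PointLineGeometry.{u}} {X S : Set Γ.Point} (hS : Γ.IsSubspace S)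
    (hX : X ⊆ S) : Γ.span X ⊆ S :=
  Set.sInter_subset_of_mem ⟨hS, hX⟩

theorem aleph0_le_generatingRank {Γ : PointLineGeometry.{u}}
    (h : ∀ X : Set Γ.Point, X.Finite → ∃ S, Γ.IsSubspace S ∧ X ⊆ S ∧ S ≠ Set.univ) :
    Cardinal.aleph0 ≤ Γ.generatingRank := by
  apply le_csInf
  -- An infimum over the empty set would be `0`, so some generating set is needed.
  · refine ⟨_, Set.univ, ?_, rfl⟩
    exact Set.eq_univ_of_univ_subset fun x hx S hS => hS.2 hx
  · rintro c ⟨X, hX, rfl⟩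
    by_contra hlt
    obtain ⟨S, hS, hXS, hne⟩ := h X (Cardinal.lt_aleph0_iff_set_finite.1 (not_le.1 hlt))
    exact hne (Set.eq_univ_of_univ_subset (hX ▸ span_subset hS hXS))

end PointLineGeometry

/-! ### Finite subfields and Frobenius -/

/-- A finite subset of an algebraic extension of `𝔽_p` lies in a finite subfield. -/
theorem exists_finite_intermediateField (p : ℕ) [Fact p.Prime] {F : Type*} [Field F]
    [Algebra (ZMod p) F] [Algebra.IsAlgebraic (ZMod p) F] {T : Set F} (hT : T.Finite) :
    ∃ E : IntermediateField (ZMod p) F, Finite E ∧ T ⊆ E := by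
  have : Finite T := hT
  have : FiniteDimensional (ZMod p) (IntermediateField.adjoin (ZMod p) T) :=
    IntermediateField.finiteDimensional_adjoin fun x _ => Algebra.IsIntegral.isIntegral x
  exact ⟨IntermediateField.adjoin (ZMod p) T, Module.finite_of_finite (ZMod p),
    IntermediateField.subset_adjoin _ _⟩

/-- A finite subset of an algebraic closure of `𝔽_p` is fixed by a nontrivial endomorphism. -/
theorem exists_ringHom_fixing (p : ℕ) [Fact p.Prime] {F : Type*} [Field F]
    [Algebra (ZMod p) F] [IsAlgClosure (ZMod p) F] {T : Set F} (hT : T.Finite) :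
    ∃ σ : F →+* F, (∀ t ∈ T, σ t = t) ∧ ∃ r, σ r ≠ r := by
  have : Algebra.IsAlgebraic (ZMod p) F := IsAlgClosure.isAlgebraic
  have : IsAlgClosed F := IsAlgClosure.isAlgClosed (ZMod p)
  have : CharP F p := charP_of_injective_algebraMap (algebraMap (ZMod p) F).injective p
  obtain ⟨E, hE, hTE⟩ := exists_finite_intermediateField p hT
  have : Fintype E := Fintype.ofFinite E
  have : CharP E p := charP_of_injective_algebraMap (algebraMap (ZMod p) E).injective p
  obtain ⟨m, hp, hm⟩ := FiniteField.card E p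
  -- With `p ^ m` the order of `E`, this power of Frobenius is the identity on `E`; its fixed points
  -- are roots of `X ^ (p ^ m) - X`, so they are finite in number.
  refine ⟨iterateFrobenius F p m, fun t ht => ?_, ?_⟩
  · rw [iterateFrobenius_def, ← hm]
    exact congrArg Subtype.val (FiniteField.pow_card (⟨t, hTE ht⟩ : E))
  · by_contra! h
    have hne := FiniteField.X_pow_card_sub_X_ne_zero F (Nat.one_lt_pow m.ne_zero hp.one_lt)
    have : Infinite F := IsAlgClosed.instInfinite
    apply hne
    apply Polynomial.eq_zero_of_infinite_isRoot
    convert Set.infinite_univ (α := F)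
    ext r
    simpa [sub_eq_zero, iterateFrobenius_def] using h r

/-! ### Proper subspaces from field endomorphisms -/

namespace BuildingA.pointHyperplane

open Module

variable {F : Type u} [Field F] {n : ℕ}

/-- The pairs `(P, H)` such that `H` contains the image of `P` under a field endomorphism
applied to all coordinates. -/
def twistedIncidence (n : ℕ) (σ : F →+* F) : Set (pointHyperplane F n).Point :=
  {x | ∀ v ∈ pt x, (fun i => σ (v i)) ∈ hy x}

/-- For fixed `H`, additivity of `σ` carries the condition from two points of a projective line to
all its points. For fixed `P`, two distinct hyperplanes through `M` meet in `M`, so the image of `P`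
lies in `M` and hence in every hyperplane through `M`. -/
theorem isSubspace_twistedIncidence (hn : 3 ≤ n) (σ : F →+* F) :
    (pointHyperplane F n).IsSubspace (twistedIncidence n σ) := by
  intro l x y hxy hxS hyS hxl hyl z hzl v hv
  obtain ⟨-, -, hx1, hx2⟩ := pt_hy_spec hn x
  obtain ⟨-, -, hy1, hy2⟩ := pt_hy_spec hn y
  rcases line_cases hn l with ⟨L, H, -, hL, -, h⟩ | ⟨P, M, -, -, hM, h⟩
  · obtain ⟨hx, hx'⟩ := (h x).1 hxl
    obtain ⟨hy, hy'⟩ := (h y).1 hyl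
    obtain ⟨hz, hz'⟩ := (h z).1 hzl
    have hne : pt x ≠ pt y := fun e => hxy (ext hn e (hx'.trans hy'.symm))
    have hvL : v ∈ pt x ⊔ pt y := by
      rw [sup_eq_of_finrank hL hx1 hy1 hx hy hne]
      exact hz hv
    obtain ⟨a, ha, b, hb, rfl⟩ := Submodule.mem_sup.1 hvL
    have h1 := hxS a ha
    have h2 := hyS b hb
    rw [hx'] at h1
    rw [hy'] at h2
    rw [hz']
    convert H.add_mem h1 h2 using 1
    ext i
    simp
  · obtain ⟨hx, hx'⟩ := (h x).1 hxl
    obtain ⟨hy, hy'⟩ := (h y).1 hyl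
    obtain ⟨hz, hz'⟩ := (h z).1 hzl
    have hne : pointHyperplane.hy x ≠ pointHyperplane.hy y :=
      fun e => hxy (ext hn (hx.trans hy.symm) e)
    apply hz'
    rw [inf_eq_of_finrank hM hx2 hy2 hx' hy' hne]
    exact ⟨hxS v (by rwa [hx, ← hz]), hyS v (by rwa [hy, ← hz])⟩

theorem exists_notMem_twistedIncidence (hn : 3 ≤ n) {σ : F →+* F} {r : F} (hr : σ r ≠ r) :
    ∃ x, x ∉ twistedIncidence n σ := by
  -- Here `f` vanishes at `v = (1, r, 0, …)` but takes the value `r - σ r` at the image of `v` under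
  -- `σ`.
  let v : Fin (n + 1) → F := Pi.single 0 1 + Pi.single 1 r
  have h01 : (1 : Fin (n + 1)) ≠ 0 := by
    rw [Ne, Fin.one_eq_zero_iff]
    omega
  let f : Dual F (Fin (n + 1) → F) := r • LinearMap.proj 0 - LinearMap.proj 1
  have hv : v ≠ 0 := fun h => by simpa [v, h01.symm] using congrFun h 0
  have hf : f ≠ 0 := fun h => by
    simpa [f, h01.symm, h01] using LinearMap.congr_fun h (Pi.single 1 1)
  have hfv : f v = 0 := by simp [f, v, h01, h01.symm]
  obtain ⟨x, hx, hx'⟩ := exists_point (A := Submodule.span F {v}) (B := LinearMap.ker f)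
    (by simpa using hfv) (finrank_span_singleton hv) (finrank_ker hf)
  refine ⟨x, fun h => hr ?_⟩
  have := h v (hx ▸ Submodule.mem_span_singleton_self v)
  rw [hx', LinearMap.mem_ker] at this
  simpa [f, v, h01, h01.symm, sub_eq_zero, eq_comm (a := r)] using this

theorem aleph0_le_generatingRank (p : ℕ) [Fact p.Prime] [Algebra (ZMod p) F]
    [IsAlgClosure (ZMod p) F] (hn : 3 ≤ n) :
    Cardinal.aleph0 ≤ (pointHyperplane F n).generatingRank := by
  apply PointLineGeometry.aleph0_le_generatingRank
  intro X hX
  choose v _ hv using fun x : (pointHyperplane F n).Point => exists_eq_span (pt_hy_spec hn x).2.2.1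
  obtain ⟨σ, hσ, r, hr⟩ := exists_ringHom_fixing p
    (T := ⋃ x ∈ X, Set.range (v x)) (hX.biUnion fun x _ => Set.finite_range _)
  refine ⟨twistedIncidence n σ, isSubspace_twistedIncidence hn σ, ?_, ?_⟩
  · intro x hx w hw
    rw [hv, Submodule.mem_span_singleton] at hw
    obtain ⟨c, rfl⟩ := hw
    have : (fun i => σ ((c • v x) i)) = σ c • v x := by
      ext i
      have : σ (v x i) = v x i := hσ _ (Set.mem_biUnion hx ⟨i, rfl⟩)
      simp [this]
    rw [this]
    apply Submodule.smul_mem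
    apply (pt_hy_spec hn x).2.1
    rw [hv]
    exact Submodule.mem_span_singleton_self _
  · obtain ⟨x, hx⟩ := exists_notMem_twistedIncidence hn hr
    exact fun h => hx (h ▸ Set.mem_univ x)

end BuildingA.pointHyperplane

/-! ### Generation of orthogonal pairs under bilinear closure -/

/-- A relation between vectors that is linear in each of its arguments. -/
structure IsBilinearRel {F ι : Type*} [Field F] (R : (ι → F) → (ι → F) → Prop) : Prop where
  zero_left : ∀ w, R 0 w
  zero_right : ∀ v, R v 0
  add_left : ∀ {v v' w}, R v w → R v' w → R (v + v') w
  add_right : ∀ {v w w'}, R v w → R v w' → R v (w + w')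
  smul_left : ∀ (c : F) {v w}, R v w → R (c • v) w
  smul_right : ∀ (c : F) {v w}, R v w → R v (c • w)

namespace IsBilinearRel

variable {F ι : Type*} [Field F] {R : (ι → F) → (ι → F) → Prop}

theorem neg_right (h : IsBilinearRel R) {v w : ι → F} (hvw : R v w) : R v (-w) := by
  simpa using h.smul_right (-1) hvw

theorem sub_left (h : IsBilinearRel R) {v v' w : ι → F} (hv : R v w) (hv' : R v' w) :
    R (v - v') w := by
  simpa [sub_eq_add_neg] using h.add_left hv (h.smul_left (-1) hv')

theorem sum_left (h : IsBilinearRel R) {κ : Type*} {s : Finset κ} {v : κ → ι → F} {w : ι → F}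
    (hv : ∀ i ∈ s, R (v i) w) : R (∑ i ∈ s, v i) w :=
  Finset.sum_induction v (R · w) (fun _ _ => h.add_left) (h.zero_left w) hv

theorem sum_right (h : IsBilinearRel R) {κ : Type*} {s : Finset κ} {v : ι → F} {w : κ → ι → F}
    (hw : ∀ i ∈ s, R v (w i)) : R v (∑ i ∈ s, w i) :=
  Finset.sum_induction w (R v ·) (fun _ _ => h.add_right) (h.zero_right v) hw

variable [DecidableEq ι]

/-- The relation between a vector with coordinates `t, s` at the places `i, j` and its
orthogonal vector supported at the same places. -/
def Pair (R : (ι → F) → (ι → F) → Prop) (i j : ι) (t s : F) : Prop :=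
  R (Pi.single i t + Pi.single j s) (Pi.single i s - Pi.single j t)

theorem Pair.symm (h : IsBilinearRel R) {i j : ι} {t s : F} (hp : Pair R i j t s) :
    Pair R j i s t := by
  simpa [Pair, add_comm] using h.neg_right hp

theorem Pair.smul (h : IsBilinearRel R) {i j : ι} {t s : F} (c : F) (hp : Pair R i j t s) :
    Pair R i j (c * t) (c * s) := by
  have := h.smul_left c (h.smul_right c hp)
  simpa [Pair, smul_sub, smul_add, ← Pi.single_smul] using this

variable [Fintype ι]

/-- Expand both vectors in unit vectors: the diagonal terms vanish and the others are multiples of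
pairs from `hE`. -/
theorem of_disjoint (h : IsBilinearRel R)
    (hE : ∀ i j, i ≠ j → R (Pi.single i 1) (Pi.single j 1)) {v w : ι → F}
    (hvw : ∀ i, v i = 0 ∨ w i = 0) : R v w := by
  rw [← Finset.univ_sum_single v, ← Finset.univ_sum_single w]
  refine h.sum_left fun i _ => h.sum_right fun j _ => ?_
  rcases eq_or_ne i j with rfl | hij
  · rcases hvw i with hi | hi
    · simpa [hi] using h.zero_left _
    · simpa [hi] using h.zero_right _
  · have := h.smul_left (v i) (h.smul_right (w j) (hE i j hij))
    simpa [← Pi.single_smul] using this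

/-- The vector `e_i + t e_j + s e_l` is related to `t e_i - e_j` and `s e_i - e_l`, the extra
coordinate being harmless by disjointness. Combining these with coefficients `-s` and `t` cancels
`e_i` on the right and leaves `s e_j - t e_l`; then `e_i` is subtracted on the left. -/
theorem Pair.third (h : IsBilinearRel R)
    (hE : ∀ i j, i ≠ j → R (Pi.single i 1) (Pi.single j 1)) {i j l : ι} (hij : i ≠ j)
    (hil : i ≠ l) (hjl : j ≠ l) {t s : F} (h₁ : Pair R i j 1 t) (h₂ : Pair R i l 1 s) :
    Pair R j l t s := by
  have e₁ : R (Pi.single i 1 + Pi.single j t + Pi.single l s)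
      (Pi.single i t - Pi.single j 1) := by
    refine h.add_left h₁ (h.of_disjoint hE fun x => ?_)
    rcases eq_or_ne x l with rfl | hx
    · simp [hil.symm, hjl.symm]
    · simp [hx]
  have e₂ : R (Pi.single i 1 + Pi.single j t + Pi.single l s)
      (Pi.single i s - Pi.single l 1) := by
    rw [add_right_comm]
    refine h.add_left h₂ (h.of_disjoint hE fun x => ?_)
    rcases eq_or_ne x j with rfl | hx
    · simp [hij.symm, hjl]
    · simp [hx]
  have e₃ : R (Pi.single i 1 + Pi.single j t + Pi.single l s)
      (Pi.single j s - Pi.single l t) := by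
    have := h.add_right (h.smul_right (-s) e₁) (h.smul_right t e₂)
    convert this using 1
    simp only [smul_sub, ← Pi.single_smul, smul_eq_mul, mul_one, neg_mul, mul_comm t s,
      Pi.single_neg]
    abel
  have e₄ : R (Pi.single i 1) (Pi.single j s - Pi.single l t) := by
    refine h.of_disjoint hE fun x => ?_
    rcases eq_or_ne x i with rfl | hx
    · simp [hij, hil]
    · simp [hx]
  have := h.sub_left e₃ e₄
  rwa [add_assoc, add_sub_cancel_left] at this

/-- Coordinate ratios multiply along `i, j, l`: invert the first pair so that both start at `j`,
apply `Pair.third`, and rescale by `t`. This turns one ratio `a` into all its powers. -/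
theorem Pair.mul (h : IsBilinearRel R)
    (hE : ∀ i j, i ≠ j → R (Pi.single i 1) (Pi.single j 1)) {i j l : ι} (hij : i ≠ j)
    (hil : i ≠ l) (hjl : j ≠ l) {t s : F} (ht : t ≠ 0) (h₁ : Pair R i j 1 t)
    (h₂ : Pair R j l 1 s) : Pair R i l 1 (t * s) := by
  have h₃ : Pair R j i 1 t⁻¹ := by
    simpa [ht] using (h₁.symm h).smul h t⁻¹
  have := (Pair.third h hE hij.symm hjl hil h₃ h₂).smul h t
  simpa [ht] using this

/-- The relation is total on orthogonal pairs `(v, w)` when the quotients of the coordinates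
of `v` are admissible. -/
theorem of_forall_pair (h : IsBilinearRel R)
    (hE : ∀ i j, i ≠ j → R (Pi.single i 1) (Pi.single j 1)) {k : Subfield F}
    (hk : ∀ t ∈ k, t ≠ 0 → ∀ i j, i ≠ j → Pair R i j 1 t) {v w : ι → F} (hv : ∀ i, v i ∈ k)
    (hvw : w ⬝ᵥ v = 0) : R v w := by
  by_cases hv0 : v = 0
  · rw [hv0]
    exact h.zero_left w
  obtain ⟨i, hi⟩ := Function.ne_iff.1 hv0
  rw [Pi.zero_apply] at hi
  -- Split `v` into its part supported on `{i, j}`, covered by an admissible ratio, and the rest,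
  -- whose support is disjoint from that of the right-hand vector.
  have key : ∀ j, j ≠ i → R v (Pi.single i (v j) - Pi.single j (v i)) := by
    intro j hj
    have e₁ : R (Pi.single i (v i) + Pi.single j (v j))
        (Pi.single i (v j) - Pi.single j (v i)) := by
      rcases eq_or_ne (v j) 0 with h0 | h0
      · refine h.of_disjoint hE fun x => ?_
        rcases eq_or_ne x i with rfl | hx
        · simp [h0, hj.symm]
        · simp [h0, hx]
      · have := (hk (v j / v i) (k.div_mem (hv j) (hv i)) (div_ne_zero h0 hi) i j hj.symm).smul
          h (v i)
        simpa [mul_div_cancel₀ _ hi, Pair] using this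
    have e₂ : R (v - (Pi.single i (v i) + Pi.single j (v j)))
        (Pi.single i (v j) - Pi.single j (v i)) := by
      refine h.of_disjoint hE fun x => ?_
      rcases eq_or_ne x i with rfl | hx
      · simp [hj.symm]
      · rcases eq_or_ne x j with rfl | hx'
        · simp [hj]
        · simp [hx, hx']
    simpa using h.add_left e₂ e₁
  -- As `v i ≠ 0`, the vectors `v_j e_i - v_i e_j` span the orthogonal space of `v`. The
  -- coefficients are read off at the places `j ≠ i`; the place `i` is then forced by orthogonality.
  -- No rationality of `w` is involved.
  have hw : w = ∑ j ∈ Finset.univ.erase i,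
      (-(w j / v i)) • (Pi.single i (v j) - Pi.single j (v i) : ι → F) := by
    rw [dotProduct, ← Finset.add_sum_erase _ _ (Finset.mem_univ i)] at hvw
    ext x
    rw [Finset.sum_apply]
    rcases eq_or_ne x i with rfl | hx
    · rw [Finset.sum_congr rfl (g := fun j => -(v x)⁻¹ * (w j * v j)), ← Finset.mul_sum]
      · rw [eq_neg_of_add_eq_zero_right hvw]
        field_simp
      · intro j hj
        have : x ≠ j := (Finset.ne_of_mem_erase hj).symm
        simp [this]
        ring
    · rw [Finset.sum_eq_single_of_mem x (by simp [hx])]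
      · simp [hx, hi]
      · intro j _ hj
        simp [hx, hj.symm]
  rw [hw]
  exact h.sum_right fun j hj => h.smul_right _ (key j (Finset.ne_of_mem_erase hj))

/-- Generation of all orthogonal pairs over the subfield `k` from the pairs of distinct unit
vectors, the pairs with coordinates `±1`, and one pair with a coordinate that generates the
multiplicative group of `k`. -/
theorem of_generators (h : IsBilinearRel R)
    (hE : ∀ i j, i ≠ j → R (Pi.single i 1) (Pi.single j 1)) {o i₁ : ι} (ho : o ≠ i₁)
    (hcard : 3 ≤ Fintype.card ι) (hone : ∀ i, i ≠ o → Pair R o i 1 1) {a : F}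
    (ha : Pair R o i₁ 1 a) {k : Subfield F} (hk : ∀ t ∈ k, t ≠ 0 → ∃ m : ℕ, a ^ m = t)
    (ha0 : a ≠ 0) {v w : ι → F} (hv : ∀ i, v i ∈ k) (hvw : w ⬝ᵥ v = 0) : R v w := by
  have hone' : ∀ i j, i ≠ j → Pair R i j 1 1 := by
    intro i j hij
    rcases eq_or_ne i o with rfl | hi
    · exact hone j hij.symm
    rcases eq_or_ne j o with rfl | hj
    · exact (hone i hi).symm h
    exact Pair.third h hE hi.symm hj.symm hij (hone i hi) (hone j hj)
  have exists_third : ∀ i j : ι, ∃ l, i ≠ l ∧ j ≠ l := by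
    intro i j
    have : ({i, j} : Finset ι).card < (Finset.univ : Finset ι).card :=
      Finset.card_le_two.trans_lt (by rw [Finset.card_univ]; omega)
    obtain ⟨l, -, hl⟩ := Finset.exists_mem_notMem_of_card_lt_card this
    simp only [Finset.mem_insert, Finset.mem_singleton, not_or] at hl
    exact ⟨l, Ne.symm hl.1, Ne.symm hl.2⟩
  -- Multiplying by ratio `1` moves a ratio to another pair of indices.
  have change_right : ∀ {i j l t}, i ≠ j → i ≠ l → t ≠ 0 → Pair R i j 1 t → Pair R i l 1 t := by
    intro i j l t hij hil ht hp
    rcases eq_or_ne j l with rfl | hjl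
    · exact hp
    · simpa using Pair.mul h hE hij hil hjl ht hp (hone' j l hjl)
  have change_left : ∀ {i j l t}, i ≠ j → l ≠ j → Pair R i j 1 t → Pair R l j 1 t := by
    intro i j l t hij hlj hp
    rcases eq_or_ne l i with rfl | hli
    · exact hp
    · simpa using Pair.mul h hE hli hlj hij one_ne_zero (hone' l i hli) hp
  have ha' : ∀ i j, i ≠ j → Pair R i j 1 a := by
    intro i j hij
    rcases eq_or_ne j o with rfl | hj
    -- When the second index is `o`, a detour through a third index is needed: `(o, l)`, then `(i,
    -- l)`, then `(i, o)`.
    · obtain ⟨l, hjl, hil⟩ := exists_third j i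
      exact change_right hil hij ha0 (change_left hjl hil (change_right ho hjl ha0 ha))
    · exact change_left hj.symm hij (change_right ho hj.symm ha0 ha)
  have hpow : ∀ m : ℕ, ∀ i j, i ≠ j → Pair R i j 1 (a ^ m) := by
    intro m
    induction m with
    | zero => simpa using hone'
    | succ m ih =>
      intro i j hij
      obtain ⟨l, hil, hjl⟩ := exists_third i j
      rw [pow_succ]
      exact Pair.mul h hE hil hij hjl.symm (pow_ne_zero _ ha0) (ih i l hil) (ha' l j hjl.symm)
  refine h.of_forall_pair hE (k := k) (fun t ht ht0 i j hij => ?_) hv hvw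
  obtain ⟨m, rfl⟩ := hk t ht ht0
  exact hpow m i j hij

end IsBilinearRel

/-! ### Subspaces and dimension bounds from embeddings -/

namespace PointLineGeometry.ProjectiveEmbedding

open Module

variable {Γ : PointLineGeometry.{u}} {K V : Type u} [DivisionRing K] [AddCommGroup V] [Module K V]

/-- By injectivity, two points of a line have distinct images, which span the whole two-dimensional
space of that line. -/
theorem isSubspace_preimage (e : Γ.ProjectiveEmbedding K V) (W : Submodule K V) :
    Γ.IsSubspace {x | (e.toFun x).submodule ≤ W} := by
  intro l x y hxy hx hy hxl hyl z hzl
  obtain ⟨U, hU, h⟩ := e.image_line l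
  have mem : ∀ z ∈ Γ.pointsOn l, (e.toFun z).submodule ≤ U := fun z hz =>
    h.subset (Set.mem_image_of_mem _ hz)
  have : FiniteDimensional K U := FiniteDimensional.of_finrank_pos (by omega)
  have hle : (e.toFun x).submodule ⊔ (e.toFun y).submodule ≤ U := sup_le (mem x hxl) (mem y hyl)
  have : FiniteDimensional K ↥((e.toFun x).submodule ⊔ (e.toFun y).submodule) :=
    Submodule.finiteDimensional_of_le hle
  have hlt : (e.toFun x).submodule < (e.toFun x).submodule ⊔ (e.toFun y).submodule := by
    refine lt_of_le_of_ne le_sup_left fun heq => hxy ?_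
    have : FiniteDimensional K (e.toFun x).submodule :=
      FiniteDimensional.of_finrank_pos (by simp [Projectivization.finrank_submodule])
    apply e.injective
    apply Projectivization.submodule_injective
    refine (Submodule.eq_of_le_of_finrank_eq (heq ▸ le_sup_right) ?_).symm
    rw [Projectivization.finrank_submodule, Projectivization.finrank_submodule]
  have hlt' := Submodule.finrank_lt_finrank_of_lt hlt
  rw [Projectivization.finrank_submodule] at hlt'
  have := Submodule.eq_of_le_of_finrank_le hle (by omega)
  calc (e.toFun z).submodule ≤ U := mem z hzl
    _ = _ := this.symm
    _ ≤ W := sup_le hx hy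

/-- An embedding has dimension at most `d` when the images of any finitely many points lie in
the span of `d` vectors. -/
theorem rank_le_of_finite (e : Γ.ProjectiveEmbedding K V) {d : ℕ}
    (h : ∀ Y : Set Γ.Point, Y.Finite → ∃ T : Finset V, T.card ≤ d ∧
      ∀ y ∈ Y, (e.toFun y).submodule ≤ Submodule.span K (T : Set V)) : Module.rank K V ≤ d := by
  classical
  have htop : Submodule.span K (Set.range fun x => (e.toFun x).rep) = ⊤ := by
    rw [Submodule.span_range_eq_iSup, ← e.spanning]
    exact iSup_congr fun x => (Projectivization.submodule_eq _).symm
  -- It suffices to bound finite independent sets; each lies in the span of finitely many image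
  -- points.
  apply rank_le
  intro s hs
  obtain ⟨T₀, hT₀, hsT₀⟩ := Submodule.subset_span_finite_of_subset_span (t := s)
    (by rw [htop]; exact Set.subset_univ _)
  rw [← Set.image_univ] at hT₀
  obtain ⟨Y, -, rfl⟩ := Finset.subset_set_image_iff.1 hT₀
  obtain ⟨T, hT, hYT⟩ := h Y Y.finite_toSet
  have hle : Submodule.span K (s : Set V) ≤ Submodule.span K (T : Set V) := by
    rw [Submodule.span_le]
    refine hsT₀.trans ?_
    rw [SetLike.coe_subset_coe, Submodule.span_le]
    intro v hv
    obtain ⟨y, hy, rfl⟩ := Finset.mem_image.1 hv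
    apply hYT y hy
    rw [Projectivization.submodule_eq]
    exact Submodule.mem_span_singleton_self _
  have := Submodule.finrank_mono hle
  rw [finrank_span_finset_eq_card hs] at this
  exact this.trans ((finrank_span_finset_le_card T).trans hT)

end PointLineGeometry.ProjectiveEmbedding

/-! ### Generation over finite subfields and the upper bound -/

namespace BuildingA.pointHyperplane

open Module

variable {F : Type u} [Field F] {n : ℕ}

/-- The subspace orthogonal to a vector. -/
def hyp (w : Fin (n + 1) → F) : Submodule F (Fin (n + 1) → F) :=
  LinearMap.ker (dotProductEquiv F (Fin (n + 1)) w)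

theorem mem_hyp {v w : Fin (n + 1) → F} : v ∈ hyp w ↔ w ⬝ᵥ v = 0 := by
  simp [hyp]

theorem exists_hy_eq_hyp (hn : 3 ≤ n) (x : (pointHyperplane F n).Point) :
    ∃ w, w ≠ 0 ∧ hy x = hyp w := by
  obtain ⟨f, hf, h⟩ := exists_eq_ker (pt_hy_spec hn x).2.2.2
  exact ⟨(dotProductEquiv F (Fin (n + 1))).symm f, by simpa using hf, by simp [h, hyp]⟩

/-- Orthogonality of two vectors together with the membership in `S` of the point of the
geometry with these coordinate vectors, if they are nonzero. -/
def CoordMem (S : Set (pointHyperplane F n).Point) (v w : Fin (n + 1) → F) : Prop :=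
  w ⬝ᵥ v = 0 ∧ ∀ x, pt x = Submodule.span F {v} → hy x = hyp w → x ∈ S

theorem hyp_smul {c : F} (hc : c ≠ 0) (w : Fin (n + 1) → F) : hyp (c • w) = hyp w := by
  ext v
  simp [mem_hyp, hc]

theorem finrank_hyp_zero : finrank F (hyp (0 : Fin (n + 1) → F)) = n + 1 := by
  rw [hyp, map_zero, LinearMap.ker_zero, finrank_top, finrank_fintype_fun_eq_card,
    Fintype.card_fin]

/-- Additivity in each argument is closure under one of the two kinds of lines. A zero vector is the
coordinate vector of no point, so membership is then vacuous; proportional summands give the same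
point and need no line. -/
theorem isBilinearRel_coordMem (hn : 3 ≤ n) {S : Set (pointHyperplane F n).Point}
    (hS : (pointHyperplane F n).IsSubspace S) : IsBilinearRel (CoordMem S) where
  zero_left w := by
    refine ⟨by simp, fun x hx => ?_⟩
    have := (pt_hy_spec hn x).2.2.1
    rw [hx, Submodule.span_zero_singleton, finrank_bot] at this
    omega
  zero_right v := by
    refine ⟨by simp, fun x _ hx => ?_⟩
    have := (pt_hy_spec hn x).2.2.2
    rw [hx, finrank_hyp_zero] at this
    omega
  smul_left c v w h := by
    refine ⟨by simp [h.1], fun x hx hx' => ?_⟩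
    rcases eq_or_ne c 0 with rfl | hc
    · have := (pt_hy_spec hn x).2.2.1
      rw [hx, zero_smul, Submodule.span_zero_singleton, finrank_bot] at this
      omega
    · rw [Submodule.span_singleton_smul_eq (Ne.isUnit hc)] at hx
      exact h.2 x hx hx'
  smul_right c v w h := by
    refine ⟨by simp [h.1], fun x hx hx' => ?_⟩
    rcases eq_or_ne c 0 with rfl | hc
    · have := (pt_hy_spec hn x).2.2.2
      rw [hx', zero_smul, finrank_hyp_zero] at this
      omega
    · rw [hyp_smul hc] at hx'
      exact h.2 x hx hx'
  add_left {v v' w} h h' := by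
    refine ⟨by simp [h.1, h'.1], fun x hx hx' => ?_⟩
    rcases eq_or_ne v 0 with rfl | hv
    · exact h'.2 x (by simpa using hx) hx'
    rcases eq_or_ne v' 0 with rfl | hv'
    · exact h.2 x (by simpa using hx) hx'
    obtain ⟨-, -, hx1, hx2⟩ := pt_hy_spec hn x
    have hw : finrank F (hyp w) = n := hx' ▸ hx2
    have hle : pt x ≤ Submodule.span F {v} ⊔ Submodule.span F {v'} := by
      rw [hx, Submodule.span_singleton_le_iff_mem]
      exact Submodule.add_mem_sup (Submodule.mem_span_singleton_self v)
        (Submodule.mem_span_singleton_self v')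
    have hv1 := finrank_span_singleton (K := F) hv
    have hv1' := finrank_span_singleton (K := F) hv'
    by_cases heq : Submodule.span F {v} = Submodule.span F {v'}
    · rw [← heq, sup_idem] at hle
      exact h.2 x (Submodule.eq_of_le_of_finrank_eq hle (by rw [hx1, hv1])) hx'
    · have hvw : Submodule.span F {v} ≤ hyp w := by simpa [mem_hyp] using h.1
      have hvw' : Submodule.span F {v'} ≤ hyp w := by simpa [mem_hyp] using h'.1
      obtain ⟨y, hy1, hy2⟩ := exists_point hvw hv1 hw
      obtain ⟨z, hz1, hz2⟩ := exists_point hvw' hv1' hw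
      obtain ⟨l, hl⟩ := exists_line_two hn (sup_le hvw hvw') (finrank_sup_of_ne hv1 hv1' heq) hw
      refine hS l y z ?_ (h.2 y hy1 hy2) (h'.2 z hz1 hz2) ((hl y).2 ⟨?_, hy2⟩)
        ((hl z).2 ⟨?_, hz2⟩) ((hl x).2 ⟨hle, hx'⟩)
      · rintro rfl
        exact heq (hy1.symm.trans hz1)
      · exact hy1.trans_le le_sup_left
      · exact hz1.trans_le le_sup_right
  add_right {v w w'} h h' := by
    refine ⟨by simp [h.1, h'.1], fun x hx hx' => ?_⟩
    rcases eq_or_ne w 0 with rfl | hw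
    · exact h'.2 x hx (by simpa using hx')
    rcases eq_or_ne w' 0 with rfl | hw'
    · exact h.2 x hx (by simpa using hx')
    obtain ⟨-, -, hx1, hx2⟩ := pt_hy_spec hn x
    have hv : finrank F (Submodule.span F {v}) = 1 := hx ▸ hx1
    have hle : hyp w ⊓ hyp w' ≤ hy x := by
      intro u hu
      have h1 := mem_hyp.1 hu.1
      have h2 := mem_hyp.1 hu.2
      rw [hx', mem_hyp, add_dotProduct, h1, h2, add_zero]
    have hw1 : finrank F (hyp w) = n := finrank_ker (by simpa using hw)
    have hw1' : finrank F (hyp w') = n := finrank_ker (by simpa using hw')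
    by_cases heq : hyp w = hyp w'
    · rw [← heq, inf_idem] at hle
      exact h.2 x hx (Submodule.eq_of_le_of_finrank_eq hle (by rw [hx2, hw1])).symm
    · have hvw : Submodule.span F {v} ≤ hyp w := by simpa [mem_hyp] using h.1
      have hvw' : Submodule.span F {v} ≤ hyp w' := by simpa [mem_hyp] using h'.1
      obtain ⟨y, hy1, hy2⟩ := exists_point hvw hv hw1
      obtain ⟨z, hz1, hz2⟩ := exists_point hvw' hv hw1'
      obtain ⟨l, hl⟩ := exists_line_codim_two hn (le_inf hvw hvw') hv
        (finrank_inf_of_ne hw1 hw1' heq)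
      refine hS l y z ?_ (h.2 y hy1 hy2) (h'.2 z hz1 hz2) ((hl y).2 ⟨hy1, ?_⟩)
        ((hl z).2 ⟨hz1, ?_⟩) ((hl x).2 ⟨hx, hle⟩)
      · rintro rfl
        exact heq (hy2.symm.trans hz2)
      · exact hy2 ▸ inf_le_left
      · exact hz2 ▸ inf_le_right

/-- The coordinate vectors of `(n + 1) ^ 2` points that generate the geometry over the subfield
whose multiplicative group is generated by `a`. -/
def generatorCoord (a : F) (q : Fin (n + 1) × Fin (n + 1)) :
    (Fin (n + 1) → F) × (Fin (n + 1) → F) :=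
  -- The count is `n(n + 1)` pairs of unit vectors, `n` pairs of ratio `1` on the nonzero diagonal
  -- indices, and one pair of ratio `a` at `(0, 0)`.
  if q.1 ≠ q.2 then (Pi.single q.1 1, Pi.single q.2 1)
  else if q.1 = 0 then (Pi.single 0 1 + Pi.single 1 a, Pi.single 0 a - Pi.single 1 1)
  else (Pi.single 0 1 + Pi.single q.1 1, Pi.single 0 1 - Pi.single q.1 1)

theorem dotProduct_generatorCoord (hn : 3 ≤ n) (a : F) (q : Fin (n + 1) × Fin (n + 1)) :
    (generatorCoord a q).2 ⬝ᵥ (generatorCoord a q).1 = 0 := by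
  have h01 : (1 : Fin (n + 1)) ≠ 0 := by
    rw [Ne, Fin.one_eq_zero_iff]
    omega
  unfold generatorCoord
  split_ifs with h₁ h₂
  · simp [h₁]
  · simp [h01, h01.symm]
  · simp [h₂, Ne.symm h₂]

/-- Only the point of the pair has to be rational over `k`; its hyperplane is arbitrary. -/
theorem mem_of_generatorCoord (hn : 3 ≤ n) {S : Set (pointHyperplane F n).Point}
    (hS : (pointHyperplane F n).IsSubspace S) {a : F} {k : Subfield F}
    (hk : ∀ t ∈ k, t ≠ 0 → ∃ m : ℕ, a ^ m = t) (ha : a ≠ 0)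
    (hgen : ∀ q, CoordMem S (generatorCoord a q).1 (generatorCoord a q).2)
    {x : (pointHyperplane F n).Point} {v : Fin (n + 1) → F} (hv : ∀ i, v i ∈ k)
    (hx : pt x = Submodule.span F {v}) : x ∈ S := by
  have h01 : (0 : Fin (n + 1)) ≠ 1 := by
    rw [Ne, eq_comm, Fin.one_eq_zero_iff]
    omega
  obtain ⟨w, -, hw⟩ := exists_hy_eq_hyp hn x
  have hvw : w ⬝ᵥ v = 0 := by
    rw [← mem_hyp, ← hw]
    exact (pt_hy_spec hn x).2.1 (hx ▸ Submodule.mem_span_singleton_self v)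
  refine ((isBilinearRel_coordMem hn hS).of_generators (fun i j hij => ?_) h01
    (by simp; omega) (fun i hi => ?_) ?_ hk ha hv hvw).2 x hx hw
  · simpa [generatorCoord, hij] using hgen (i, j)
  · simpa [generatorCoord, hi, IsBilinearRel.Pair] using hgen (i, i)
  · simpa [generatorCoord, IsBilinearRel.Pair] using hgen (0, 0)

theorem rank_le_of_embedding (p : ℕ) [Fact p.Prime] [Algebra (ZMod p) F]
    [Algebra.IsAlgebraic (ZMod p) F] (hn : 3 ≤ n) {K V : Type u} [DivisionRing K]
    [AddCommGroup V] [Module K V] (e : (pointHyperplane F n).ProjectiveEmbedding K V) :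
    Module.rank K V ≤ ((n + 1) ^ 2 : ℕ) := by
  classical
  apply e.rank_le_of_finite
  intro Y hY
  choose v _ hv using fun x : (pointHyperplane F n).Point => exists_eq_span (pt_hy_spec hn x).2.2.1
  obtain ⟨E, hE, hYE⟩ := exists_finite_intermediateField p
    (T := ⋃ x ∈ Y, Set.range (v x)) (hY.biUnion fun x _ => Set.finite_range _)
  obtain ⟨a, ha⟩ := IsCyclic.exists_generator (α := Eˣ)
  -- The default `0` is harmless: if no point has these coordinates, there is nothing to check for
  -- `q`.
  let vec : Fin (n + 1) × Fin (n + 1) → V := fun q =>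
    if h : ∃ x, pt x = Submodule.span F {(generatorCoord ((a : E) : F) q).1} ∧
      hy x = hyp (generatorCoord ((a : E) : F) q).2 then (e.toFun h.choose).rep else 0
  refine ⟨Finset.univ.image vec, ?_, fun y hyY => ?_⟩
  · refine Finset.card_image_le.trans ?_
    simp [sq]
  · refine mem_of_generatorCoord hn (e.isSubspace_preimage _) (a := ((a : E) : F))
      (k := E.toSubfield) ?_ ?_ (fun q => ⟨dotProduct_generatorCoord hn _ q, ?_⟩) (v := v y)
      (fun i => hYE (Set.mem_biUnion hyY ⟨i, rfl⟩)) (hv y)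
    · intro t ht ht0
      have ht0' : (⟨t, ht⟩ : E) ≠ 0 := fun h => ht0 (congrArg Subtype.val h)
      -- Since `Eˣ` is finite, natural exponents suffice.
      obtain ⟨m, hm⟩ := mem_powers_iff_mem_zpowers.2 (ha (Units.mk0 _ ht0'))
      refine ⟨m, ?_⟩
      have := congrArg (fun u : Eˣ => ((u : E) : F)) hm
      simpa using this
    · simp
    · intro x hx hx'
      have h : ∃ x, pt x = Submodule.span F {(generatorCoord ((a : E) : F) q).1} ∧
        hy x = hyp (generatorCoord ((a : E) : F) q).2 := ⟨x, hx, hx'⟩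
      have hxe : h.choose = x :=
        ext hn (h.choose_spec.1.trans hx.symm) (h.choose_spec.2.trans hx'.symm)
      rw [Set.mem_ofPred_eq, Projectivization.submodule_eq,
        Submodule.span_singleton_le_iff_mem]
      apply Submodule.subset_span
      rw [Finset.coe_image, Finset.coe_univ, Set.image_univ]
      refine ⟨q, ?_⟩
      simp only [vec]
      rw [dif_pos h, hxe]

/-! ### The natural embedding and the lower bound -/

theorem range_smulRight {V : Type*} [AddCommGroup V] [Module F V] {f : Dual F V} (hf : f ≠ 0)
    (v : V) : LinearMap.range (f.smulRight v) = Submodule.span F {v} := by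
  obtain ⟨u, hu⟩ := DFunLike.ne_iff.1 hf
  rw [LinearMap.zero_apply] at hu
  apply le_antisymm
  · rintro _ ⟨x, rfl⟩
    exact Submodule.smul_mem _ _ (Submodule.mem_span_singleton_self v)
  · rw [Submodule.span_singleton_le_iff_mem]
    exact ⟨(f u)⁻¹ • u, by simp [hu]⟩

theorem ker_smulRight {V : Type*} [AddCommGroup V] [Module F V] (f : Dual F V) {v : V}
    (hv : v ≠ 0) : LinearMap.ker (f.smulRight v) = LinearMap.ker f := by
  ext x
  simp [hv]

/-- The span of the nilpotent endomorphisms of rank one. -/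
def rankOneSpan (F : Type u) [Field F] (n : ℕ) :
    Submodule F ((Fin (n + 1) → F) →ₗ[F] (Fin (n + 1) → F)) :=
  Submodule.span F {g | ∃ (f : Dual F (Fin (n + 1) → F)) (v : Fin (n + 1) → F),
    f v = 0 ∧ f.smulRight v = g}

theorem smulRight_mem_rankOneSpan {f : Dual F (Fin (n + 1) → F)} {v : Fin (n + 1) → F}
    (h : f v = 0) : f.smulRight v ∈ rankOneSpan F n :=
  Submodule.subset_span ⟨f, v, h, rfl⟩

/-- Adjoining the single matrix unit `E 0 0` gives all endomorphisms: off-diagonal units are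
nilpotent of rank one, and the diagonal ones differ from `E 0 0` by elements of the span. -/
theorem le_finrank_rankOneSpan : (n + 1) ^ 2 - 1 ≤ finrank F (rankOneSpan F n) := by
  let pr : Fin (n + 1) → Dual F (Fin (n + 1) → F) := fun i => LinearMap.proj i
  let E : Fin (n + 1) → Fin (n + 1) → (Fin (n + 1) → F) →ₗ[F] (Fin (n + 1) → F) :=
    fun i j => (pr j).smulRight (Pi.single i 1)
  have hE : ∀ i j, i ≠ j → E i j ∈ rankOneSpan F n := fun i j hij =>
    smulRight_mem_rankOneSpan (by simp [pr, hij.symm])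
  have hmem : ∀ i j, E i j ∈ rankOneSpan F n ⊔ Submodule.span F {E 0 0} := by
    intro i j
    by_cases hij : i = j
    · subst hij
      by_cases hi : i = 0
      · subst hi
        exact Submodule.mem_sup_right (Submodule.mem_span_singleton_self _)
      · have h₁ : (pr i - pr 0).smulRight
            (Pi.single i 1 + Pi.single 0 1) ∈ rankOneSpan F n :=
          smulRight_mem_rankOneSpan (by
            simp [pr, hi, Ne.symm hi])
        -- The rank-one map of `h₁` expands to `E i i + E 0 i - E i 0 - E 0 0`.
        have h₂ : E i i = (pr i - pr 0).smulRight (Pi.single i 1 + Pi.single 0 1) + E i 0 - E 0 i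
              + E 0 0 := by
          ext x y
          simp [E, pr]
          ring
        rw [h₂]
        refine Submodule.add_mem_sup ?_ (Submodule.mem_span_singleton_self _)
        exact Submodule.sub_mem _ (Submodule.add_mem _ h₁ (hE _ _ hi)) (hE _ _ (Ne.symm hi))
    · exact Submodule.mem_sup_left (hE i j hij)
  have htop : rankOneSpan F n ⊔ Submodule.span F {E 0 0} = ⊤ := by
    rw [eq_top_iff]
    intro g _
    have hg : g = ∑ j, ∑ i, g (Pi.single j 1) i • E i j := by
      apply LinearMap.pi_ext'
      intro l
      ext x
      simp [E, pr, Finset.sum_apply, Pi.single_apply, ite_apply]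
    rw [hg]
    exact Submodule.sum_mem _ fun j _ => Submodule.sum_mem _ fun i _ =>
      Submodule.smul_mem _ _ (hmem i j)
  have h := Submodule.finrank_add_le_finrank_add_finrank (rankOneSpan F n)
    (Submodule.span F {E 0 0})
  rw [htop, finrank_top, finrank_linearMap, finrank_fintype_fun_eq_card, Fintype.card_fin] at h
  have h1 := finrank_span_le_card (R := F) ({E 0 0} : Set _)
  simp only [Set.toFinset_singleton, Finset.card_singleton] at h1
  rw [sq]
  omega

/-- The image of a point with coordinates `(v, f)` in the natural embedding. -/
def tensorVec {f : Dual F (Fin (n + 1) → F)} {v : Fin (n + 1) → F} (h : f v = 0) :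
    rankOneSpan F n := ⟨f.smulRight v, smulRight_mem_rankOneSpan h⟩

theorem tensorVec_ne_zero {f : Dual F (Fin (n + 1) → F)} {v : Fin (n + 1) → F} (h : f v = 0)
    (hf : f ≠ 0) (hv : v ≠ 0) : tensorVec h ≠ 0 := by
  intro h0
  have h0' : f.smulRight v = 0 := congrArg Subtype.val h0
  have := range_smulRight hf v
  rw [h0', LinearMap.range_zero, eq_comm, Submodule.span_singleton_eq_bot] at this
  exact hv this

theorem exists_coord (hn : 3 ≤ n) (x : (pointHyperplane F n).Point) :
    ∃ (f : Dual F (Fin (n + 1) → F)) (v : Fin (n + 1) → F), f ≠ 0 ∧ v ≠ 0 ∧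
      pt x = Submodule.span F {v} ∧ hy x = LinearMap.ker f ∧ f v = 0 := by
  obtain ⟨-, hle, h1, h2⟩ := pt_hy_spec hn x
  obtain ⟨v, hv, hv'⟩ := exists_eq_span h1
  obtain ⟨f, hf, hf'⟩ := exists_eq_ker h2
  refine ⟨f, v, hf, hv, hv', hf', ?_⟩
  rw [hv', hf', Submodule.span_singleton_le_iff_mem] at hle
  exact hle

/-- Functionals with the same kernel are proportional, so the image point does not depend on the
chosen coordinates. -/
theorem span_tensorVec {f f' : Dual F (Fin (n + 1) → F)} {v v' : Fin (n + 1) → F} (h : f v = 0)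
    (h' : f' v' = 0) (hf : LinearMap.ker f = LinearMap.ker f')
    (hv : Submodule.span F {v} = Submodule.span F {v'}) :
    Submodule.span F {tensorVec h} = Submodule.span F {tensorVec h'} := by
  have key : ∀ {f f' : Dual F (Fin (n + 1) → F)} {v v' : Fin (n + 1) → F} (h : f v = 0)
      (h' : f' v' = 0), LinearMap.ker f = LinearMap.ker f' →
      Submodule.span F {v} = Submodule.span F {v'} →
      tensorVec h ∈ Submodule.span F {tensorVec h'} := by
    intro f f' v v' h h' hf hv
    obtain ⟨c, rfl⟩ := Submodule.mem_span_singleton.1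
      (hv ▸ Submodule.mem_span_singleton_self v : v ∈ Submodule.span F {v'})
    obtain ⟨d, rfl⟩ : ∃ d : F, d • f' = f := by
      have := mem_span_of_iInf_ker_le_ker (L := fun _ : Unit => f') (K := f) (by simp [hf])
      rw [Set.range_const] at this
      exact Submodule.mem_span_singleton.1 this
    refine Submodule.mem_span_singleton.2 ⟨c * d, Subtype.ext ?_⟩
    ext x y
    simp [tensorVec]
    ring
  apply le_antisymm <;> rw [Submodule.span_singleton_le_iff_mem]
  exacts [key h h' hf hv, key h' h hf.symm hv.symm]

theorem isProjectiveLine_of_linearMap {K V D : Type u} [Field K] [AddCommGroup V]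
    [Module K V] [AddCommGroup D] [Module K D] (g : D →ₗ[K] V) (hg : ∀ d, g d = 0 → d = 0)
    (hD : finrank K D = 2) {S : Set (Projectivization K V)}
    (h₁ : ∀ x ∈ S, ∃ d, x.submodule = Submodule.span K {g d})
    (h₂ : ∀ d, d ≠ 0 → ∃ x ∈ S, x.submodule = Submodule.span K {g d}) :
    PointLineGeometry.IsProjectiveLine K V S := by
  refine ⟨LinearMap.range g, (LinearMap.finrank_range_of_inj
    ((injective_iff_map_eq_zero g).2 hg)).trans hD, ?_⟩
  ext x
  constructor
  · intro hx
    obtain ⟨d, hd⟩ := h₁ x hx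
    simp [hd]
  · intro hx
    obtain ⟨d, hd⟩ : x.rep ∈ LinearMap.range g := by
      apply hx
      rw [Projectivization.submodule_eq]
      exact Submodule.mem_span_singleton_self _
    obtain ⟨y, hy, hyd⟩ := h₂ d (by
      rintro rfl
      exact x.rep_nonzero (by rw [← hd, map_zero]))
    rw [hd, ← Projectivization.submodule_eq] at hyd
    rwa [← Projectivization.submodule_injective hyd]

theorem exists_embedding (hn : 3 ≤ n) :
    Nonempty ((pointHyperplane F n).ProjectiveEmbedding F (rankOneSpan F n)) := by
  choose f v hf hv hpt hhy hfv using exists_coord (F := F) hn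
  let e : (pointHyperplane F n).Point → Projectivization F (rankOneSpan F n) := fun x =>
    Projectivization.mk F (tensorVec (hfv x)) (tensorVec_ne_zero (hfv x) (hf x) (hv x))
  have he : ∀ x (g : Dual F (Fin (n + 1) → F)) (w : Fin (n + 1) → F) (h : g w = 0),
      pt x = Submodule.span F {w} → hy x = LinearMap.ker g →
      (e x).submodule = Submodule.span F {tensorVec h} := by
    intro x g w h hw hg
    rw [Projectivization.submodule_mk]
    exact span_tensorVec _ _ ((hhy x).symm.trans hg) ((hpt x).symm.trans hw)
  refine ⟨⟨e, fun x y hxy => ?_, fun l => ?_, ?_⟩⟩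
  · obtain ⟨a, ha⟩ := (Projectivization.mk_eq_mk_iff' _ _ _ _ _).1 hxy
    have ha' : a • (f y).smulRight (v y) = (f x).smulRight (v x) := congrArg Subtype.val ha
    have ha0 : a ≠ 0 := by
      rintro rfl
      rw [zero_smul] at ha
      exact tensorVec_ne_zero (hfv x) (hf x) (hv x) ha.symm
    -- The range of `f ⊗ v` recovers the point and its kernel the hyperplane.
    apply ext hn
    · rw [hpt, hpt, ← range_smulRight (hf x), ← range_smulRight (hf y), ← ha',
        LinearMap.range_smul _ _ ha0]
    · rw [hhy, hhy, ← ker_smulRight _ (hv x), ← ker_smulRight _ (hv y), ← ha',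
        LinearMap.ker_smul _ _ ha0]
  · rcases line_cases hn l with ⟨L, H, hLH, hL, hH, h⟩ | ⟨P, M, hPM, hP, hM, h⟩
    · obtain ⟨φ, hφ, rfl⟩ := exists_eq_ker hH
      let g : L →ₗ[F] rankOneSpan F n := LinearMap.codRestrict _
        (LinearMap.smulRightₗ φ ∘ₗ L.subtype) fun w => smulRight_mem_rankOneSpan (hLH w.2)
      refine isProjectiveLine_of_linearMap g ?_ hL ?_ ?_
      · intro w hw
        by_contra hw0
        exact tensorVec_ne_zero (hLH w.2) hφ (by simpa using hw0) hw
      · rintro _ ⟨x, hx, rfl⟩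
        obtain ⟨hx1, hx2⟩ := (h x).1 hx
        have hvL : v x ∈ L := hx1 (by rw [hpt]; exact Submodule.mem_span_singleton_self _)
        exact ⟨⟨v x, hvL⟩, he x φ (v x) (hLH hvL) (hpt x) hx2⟩
      · intro w hw
        have hw0 : (w : Fin (n + 1) → F) ≠ 0 := by simpa using hw
        have hwL : Submodule.span F {(w : Fin (n + 1) → F)} ≤ L := by simp
        obtain ⟨x, hx1, hx2⟩ := exists_point (hwL.trans hLH) (finrank_span_singleton hw0) hH
        exact ⟨_, ⟨x, (h x).2 ⟨hx1.trans_le hwL, hx2⟩, rfl⟩, he x φ w (hLH w.2) hx1 hx2⟩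
    · obtain ⟨w, hw, rfl⟩ := exists_eq_span hP
      have hwM : w ∈ M := by simpa using hPM
      have hann : ∀ φ : M.dualAnnihilator, (φ : Dual F (Fin (n + 1) → F)) w = 0 := fun φ =>
        (Submodule.mem_dualAnnihilator _).1 φ.2 w hwM
      -- Hyperplanes through `M` correspond to functionals, up to scalars, in the annihilator of
      -- `M`, of dimension `(n + 1) - (n - 1) = 2`.
      let g : M.dualAnnihilator →ₗ[F] rankOneSpan F n := LinearMap.codRestrict _
        (LinearMap.smulRightₗ.flip w ∘ₗ M.dualAnnihilator.subtype)
        fun φ => smulRight_mem_rankOneSpan (hann φ)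
      have hdim : finrank F M.dualAnnihilator = 2 := by
        have := Subspace.finrank_add_finrank_dualAnnihilator_eq M
        rw [hM, finrank_fintype_fun_eq_card, Fintype.card_fin] at this
        omega
      refine isProjectiveLine_of_linearMap (D := M.dualAnnihilator) g ?_ hdim ?_ ?_
      · intro φ hφ
        by_contra hφ0
        exact tensorVec_ne_zero (hann φ) (by simpa using hφ0) hw hφ
      · rintro _ ⟨x, hx, rfl⟩
        obtain ⟨hx1, hx2⟩ := (h x).1 hx
        have hfM : f x ∈ M.dualAnnihilator := by
          rw [Submodule.mem_dualAnnihilator]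
          intro u hu
          have := hx2 hu
          rwa [hhy] at this
        exact ⟨⟨f x, hfM⟩, he x (f x) w (hann ⟨f x, hfM⟩) hx1 (hhy x)⟩
      · intro φ hφ
        have hφ0 : (φ : Dual F (Fin (n + 1) → F)) ≠ 0 := by simpa using hφ
        have hφM : M ≤ LinearMap.ker (φ : Dual F (Fin (n + 1) → F)) := fun u hu =>
          (Submodule.mem_dualAnnihilator _).1 φ.2 u hu
        obtain ⟨x, hx1, hx2⟩ := exists_point (hPM.trans hφM) hP (finrank_ker hφ0)
        exact ⟨_, ⟨x, (h x).2 ⟨hx1, hφM.trans_eq hx2.symm⟩, rfl⟩, he x φ w (hann φ) hx1 hx2⟩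
  · rw [eq_top_iff]
    have : Submodule.span F (Subtype.val ⁻¹' {g | ∃ (f : Dual F (Fin (n + 1) → F))
        (v : Fin (n + 1) → F), f v = 0 ∧ f.smulRight v = g} : Set (rankOneSpan F n)) = ⊤ :=
      Submodule.span_span_coe_preimage
    rw [← this, Submodule.span_le]
    rintro ⟨_, hmem⟩ ⟨φ, w, hφw, rfl⟩
    change tensorVec hφw ∈ _
    by_cases hφ : φ = 0
    · have : tensorVec hφw = 0 := Subtype.ext (by simp [tensorVec, hφ])
      rw [this]
      exact Submodule.zero_mem _
    by_cases hw : w = 0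
    · have : tensorVec hφw = 0 := Subtype.ext (by simp [tensorVec, hw])
      rw [this]
      exact Submodule.zero_mem _
    obtain ⟨x, hx1, hx2⟩ := exists_point (A := Submodule.span F {w}) (B := LinearMap.ker φ)
      (by simpa using hφw) (finrank_span_singleton hw) (finrank_ker hφ)
    apply Submodule.mem_iSup_of_mem x
    rw [he x φ w hφw hx1 hx2]
    exact Submodule.mem_span_singleton_self _

/-! ### The embedding rank between the two bounds -/

theorem embeddingRank_le (p : ℕ) [Fact p.Prime] [Algebra (ZMod p) F]
    [Algebra.IsAlgebraic (ZMod p) F] (hn : 3 ≤ n) :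
    (pointHyperplane F n).embeddingRank ≤ ((n + 1) ^ 2 : ℕ) := by
  apply csSup_le'
  rintro c ⟨K, _, V, _, _, ⟨e⟩, rfl⟩
  exact rank_le_of_embedding p hn e

theorem le_embeddingRank (p : ℕ) [Fact p.Prime] [Algebra (ZMod p) F]
    [Algebra.IsAlgebraic (ZMod p) F] (hn : 3 ≤ n) :
    (((n + 1) ^ 2 - 1 : ℕ) : Cardinal.{u}) ≤ (pointHyperplane F n).embeddingRank := by
  have hrank : (((n + 1) ^ 2 - 1 : ℕ) : Cardinal.{u}) ≤ Module.rank F (rankOneSpan F n) := by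
    rw [← finrank_eq_rank]
    exact_mod_cast le_finrank_rankOneSpan
  -- The upper bound is needed here too, as a supremum only dominates its members when the set is
  -- bounded.
  refine hrank.trans (le_csSup ⟨((n + 1) ^ 2 : ℕ), ?_⟩
    ⟨F, inferInstance, rankOneSpan F n, inferInstance, inferInstance, exists_embedding hn, rfl⟩)
  rintro c ⟨K, _, V, _, _, ⟨e⟩, rfl⟩
  exact rank_le_of_embedding p hn e

end BuildingA.pointHyperplane

theorem theorem1p5 (p : ℕ) [Fact p.Prime] (F : Type u) [Field F] [Algebra (ZMod p) F]
    [IsAlgClosure (ZMod p) F] (n : ℕ) (hn : 3 ≤ n) :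
    Cardinal.aleph0 ≤ (BuildingA.grassmannian F n {1, n}).generatingRank ∧
      ((BuildingA.grassmannian F n {1, n}).embeddingRank = (((n + 1) ^ 2 - 1 : ℕ) : Cardinal.{u}) ∨
        (BuildingA.grassmannian F n {1, n}).embeddingRank = (((n + 1) ^ 2 : ℕ) : Cardinal.{u})) := by
  refine ⟨BuildingA.pointHyperplane.aleph0_le_generatingRank p hn, ?_⟩
  have : Algebra.IsAlgebraic (ZMod p) F := IsAlgClosure.isAlgebraic
  have hle := BuildingA.pointHyperplane.embeddingRank_le (F := F) p hn
  have hge := BuildingA.pointHyperplane.le_embeddingRank (F := F) p hn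
  obtain ⟨d, hd⟩ := Cardinal.lt_aleph0.1 (hle.trans_lt Cardinal.natCast_lt_aleph0)
  rw [hd] at hle hge ⊢
  norm_cast at hle hge ⊢
  omega
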